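/- Let $N$ be a positive integer and let $\mathcal D_N$ be the set of complex symmetric $N\times N$ matrices $A$ with $A^*A<I$. For $A\in\mathcal D_N$ put $Q_A(z)=zAz^T$ ($z\in\mathbb C^N$ a row vector). Fix $w\in\mathbb C^N$ with $|w|=1$, and for $k=1,2,\dots$ and $z\in\mathbb C^N$ let $$\psi_{A,w}(z)=e^{kQ_A(z-w)/2}\,e^{kz\overline w^T}\,e^{-k|w|^2/2}\,e^{-k|z|^2/2},\qquad \Psi_{A,w}(z)=\frac1{2\pi}\int_0^{2\pi}e^{-ikt}\,\psi_{A,w}(e^{it}z)\,dt .$$ Let $\mathcal H_w=(\mathbb Cw)^\perp$ be the Hermitian orthogonal complement of $\mathbb Cw$. For every $A\in\mathcal D_N$ the limit $$\sigma_A(\eta)=\lim_{k\to\infty}\sqrt k\,\Psi_{A,w}\bigl(w+\eta/\sqrt k\bigr),\qquad \eta\in\mathcal H_w,$$ exists; the function $\sigma_A:\mathcal H_w\to\mathbb C$ is called the symbol of $\Psi_{A,w}$. If $A,B\in\mathcal D_N$ satisfy $\sigma_A=\sigma_B$ on $\mathcal H_w$, then $$\|\Psi_{A,w}-\Psi_{B,w}\|^2_{L^2(S^{2N-1})}=O(k^{-N-1})\qquad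 (k\to\infty),$$ where $S^{2N-1}$ is the unit sphere of $\mathbb C^N$ with its surface measure. -/

import Mathlib

open MeasureTheory Filter Topology Asymptotics
open scoped Matrix ComplexConjugate ComplexOrder

noncomputable section

namespace Squeezed

/-- The Hermitian space `ℂ^N`. -/
abbrev CN (N : ℕ) : Type := EuclideanSpace ℂ (Fin N)

/-- The generalized unit disk: complex symmetric `N × N` matrices `A` with `A^* A < I`. -/
def genDisk (N : ℕ) : Set (Matrix (Fin N) (Fin N) ℂ) :=
  {A | A.IsSymm ∧ (1 - Aᴴ * A).PosDef}

/-- The quadratic form `Q_A(z) = z A z^T`. -/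
def quadForm {N : ℕ} (A : Matrix (Fin N) (Fin N) ℂ) (z : CN N) : ℂ :=
  ∑ i, ∑ j, z i * A i j * z j

/-- The complex bilinear expression `z (conj w)^T`. -/
def hermPair {N : ℕ} (z w : CN N) : ℂ :=
  ∑ i, z i * conj (w i)

/-- The Gaussian coherent state `ψ_{A,w}` on `ℂ^N` at level `k = 1/ℏ`. -/
def gaussianState {N : ℕ} (k : ℕ) (A : Matrix (Fin N) (Fin N) ℂ) (w z : CN N) : ℂ :=
  Complex.exp ((k : ℂ) * quadForm A (z - w) / 2) *
    Complex.exp ((k : ℂ) * hermPair z w) *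
    Complex.exp (-((k : ℂ) * ((‖w‖ ^ 2 : ℝ) : ℂ) / 2)) *
    Complex.exp (-((k : ℂ) * ((‖z‖ ^ 2 : ℝ) : ℂ) / 2))

/-- The reduction operator `(R_k ψ)(z) = (1/2π) ∫_0^{2π} e^{-ikt} ψ(e^{it} z) dt`.  The formula is
used on the unit sphere and also at the points `w + η/√k` near it. -/
def reduction {N : ℕ} (k : ℕ) (ψ : CN N → ℂ) (z : CN N) : ℂ :=
  1 / (2 * (Real.pi : ℂ)) *
    ∫ t in (0 : ℝ)..(2 * Real.pi),
      Complex.exp (-(Complex.I * (k : ℂ) * (t : ℂ))) * ψ (Complex.exp (Complex.I * (t : ℂ)) • z)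

/-- The reduced state `Ψ_{A,w} = R_k(ψ_{A,w})`. -/
def reducedState {N : ℕ} (k : ℕ) (A : Matrix (Fin N) (Fin N) ℂ) (w : CN N) : CN N → ℂ :=
  reduction k (gaussianState k A w)

/-- `H_w`, the Hermitian orthogonal complement of the complex line spanned by `w`. -/
abbrev horizontal {N : ℕ} (w : CN N) : Submodule ℂ (CN N) := (Submodule.span ℂ {w})ᗮ

/-- The rescaled reduced state `√k Ψ_{A,w}(w + η/√k)`. -/
def rescaledState {N : ℕ} (A : Matrix (Fin N) (Fin N) ℂ) (w : CN N) (η : horizontal w) (k : ℕ) :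
    ℂ :=
  ((√(k : ℝ) : ℝ) : ℂ) * reducedState k A w (w + (((√(k : ℝ))⁻¹ : ℝ) : ℂ) • (η : CN N))

/-- The symbol `σ_A : H_w → ℂ`, `σ_A(η) = lim_{k → ∞} √k Ψ_{A,w}(w + η/√k)`. -/
def symbol {N : ℕ} (A : Matrix (Fin N) (Fin N) ℂ) (w : CN N) (η : horizontal w) : ℂ :=
  limUnder atTop (rescaledState A w η)

/-- The squared norm of a function on `ℂ^N` in `L²(S^{2N-1})`, for the surface measure of the unit
sphere. -/
def sphereNormSq {N : ℕ} (f : CN N → ℂ) : ℝ :=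
  ∫ z : Metric.sphere (0 : CN N) 1, ‖f z‖ ^ 2 ∂((volume : Measure (CN N)).toSphere)

theorem continuous_reducedState {N : ℕ} (k : ℕ) (A : Matrix (Fin N) (Fin N) ℂ) (w : CN N) :
    Continuous (reducedState k A w) := by
  unfold reducedState reduction
  refine continuous_const.mul ?_
  apply intervalIntegral.continuous_parametric_intervalIntegral_of_continuous'
  unfold Function.uncurry gaussianState quadForm hermPair
  fun_prop

/-- The integrand in the squared norm of a difference of reduced states is integrable. -/
theorem integrable_reducedState_sub {N : ℕ} (k : ℕ) (A B : Matrix (Fin N) (Fin N) ℂ) (w : CN N) :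
    Integrable (fun z : Metric.sphere (0 : CN N) 1 =>
      ‖(reducedState k A w - reducedState k B w) z‖ ^ 2)
      ((volume : Measure (CN N)).toSphere) := by
  have hc : Continuous (fun z : Metric.sphere (0 : CN N) 1 =>
      ‖(reducedState k A w - reducedState k B w) z‖ ^ 2) :=
    ((((continuous_reducedState k A w).sub (continuous_reducedState k B w)).comp
      continuous_subtype_val).norm).pow 2
  exact hc.integrable_of_hasCompactSupport (HasCompactSupport.of_compactSpace _)

end Squeezed

end

/-! Since |w| = 1, completing the square turns the integrand of the reduced state at z into
exp(kΦ(t)), where Φ(t) = E(e^{it}z - w) + i(Im(e^{it}⟨w,z⟩) - t) and E(v) = Q_A(v)/2 - |v|²/2. The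
condition A*A < I and compactness give Re E(v) ≤ -c|v|², so the integrand is dominated by a
Gaussian.

For z = rw + ζ with ζ ⊥ w and 1 - r ≤ |ζ|², the phase equals E(itw + ζ) up to a cubic error in (t,
|ζ|). Rescaling t by √k gives, uniformly in ζ, Ψ_A(z) = k^{-1/2} S_A(√k ζ) + O(k^{-1} e^{-ck|ζ|²}),
where S_A is `symbolIntegral` (`exists_norm_reducedState_sub_le`). Taking r = 1 and ζ = η/√k shows
that the symbol exists and equals S_A; no closed form of S_A is needed.

If the symbols agree, the leading terms cancel. Circle equivariance brings every z on the sphere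
with |⟨w,z⟩| ≥ 1/2 to the form above, and elsewhere both states are exponentially small. The squared
difference is thus O(k^{-2} e^{-2ck|ζ|²}) with |ζ|² = 1 - |⟨w,z⟩|², and integrating this Gaussian
over the sphere gains k^{-(N-1)} (`integral_sphere_exp_le`). -/

noncomputable section

namespace Squeezed

/-! ### Gaussian integrals and polar coordinates. -/

section Sphere

variable {V : Type*} [NormedAddCommGroup V] [InnerProductSpace ℝ V] [FiniteDimensional ℝ V]
  [MeasurableSpace V] [BorelSpace V]

theorem lintegral_exp_neg_mul_norm_sq {b : ℝ} (hb : 0 < b) :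
    ∫⁻ v : V, ENNReal.ofReal (Real.exp (-b * ‖v‖ ^ 2)) =
      ENNReal.ofReal ((Real.pi / b) ^ (Module.finrank ℝ V / 2 : ℝ)) := by
  have h := GaussianFourier.integral_rexp_neg_mul_sq_norm (V := V) hb
  rw [← h, ofReal_integral_eq_lintegral_ofReal _ (.of_forall fun _ => (Real.exp_pos _).le)]
  apply Integrable.of_integral_ne_zero
  rw [h]
  positivity

/-- The integral of an anisotropic Gaussian adapted to a subspace and its complement. -/
theorem lintegral_exp_neg_starProjection (K : Submodule ℝ V) {a b : ℝ} (ha : 0 < a) (hb : 0 < b) :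
    ∫⁻ v : V, ENNReal.ofReal
        (Real.exp (-a * ‖K.starProjection v‖ ^ 2 - b * ‖v - K.starProjection v‖ ^ 2)) =
      ENNReal.ofReal ((Real.pi / a) ^ (Module.finrank ℝ K / 2 : ℝ) *
        (Real.pi / b) ^ (Module.finrank ℝ Kᗮ / 2 : ℝ)) := by
  have hmp := (WithLp.volume_preserving_ofLp K Kᗮ).comp
    (LinearIsometryEquiv.measurePreserving K.orthogonalDecomposition)
  have hF : Measurable fun p : K × Kᗮ => ENNReal.ofReal (Real.exp (-a * ‖p.1‖ ^ 2)) *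
      ENNReal.ofReal (Real.exp (-b * ‖p.2‖ ^ 2)) := by fun_prop
  have h := hmp.lintegral_comp hF
  rw [ENNReal.ofReal_mul (by positivity), ← lintegral_exp_neg_mul_norm_sq ha,
    ← lintegral_exp_neg_mul_norm_sq hb]
  rw [Measure.volume_eq_prod, lintegral_prod_mul (f := fun v : K => ENNReal.ofReal (Real.exp (-a * ‖v‖ ^ 2)))
    (g := fun v : Kᗮ => ENNReal.ofReal (Real.exp (-b * ‖v‖ ^ 2))) (by fun_prop) (by fun_prop)] at h
  rw [← h]
  refine lintegral_congr fun v => ?_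
  rw [← ENNReal.ofReal_mul (Real.exp_pos _).le, ← Real.exp_add]
  have h1 : v - K.starProjection v = Kᗮ.starProjection v := by
    rw [sub_eq_iff_eq_add', K.starProjection_add_starProjection_orthogonal]
  rw [h1]
  simp only [Function.comp_apply, Submodule.orthogonalDecomposition_apply, Submodule.coe_norm,
    Submodule.coe_orthogonalProjectionOnto_apply, sub_eq_add_neg, neg_mul]

/-- A function on the unit sphere dominated radially inside the unit ball. -/
theorem lintegral_toSphere_le [Nontrivial V] (f : Metric.sphere (0 : V) 1 → ENNReal)
    (F : V → ENNReal) (hf : Measurable f)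
    (h : ∀ s : Metric.sphere (0 : V) 1, ∀ ρ : ℝ, 0 < ρ → ρ < 1 → f s ≤ F (ρ • (s : V))) :
    ∫⁻ s, f s ∂((volume : Measure V).toSphere) ≤ Module.finrank ℝ V * ∫⁻ v : V, F v := by
  set n := Module.finrank ℝ V with hn
  have hnpos : 0 < n := Module.finrank_pos
  have hmp := (volume : Measure V).measurePreserving_homeomorphUnitSphereProd
  set ν := Measure.volumeIoiPow (n - 1) with hν
  set I : Set (Set.Ioi (0 : ℝ)) := Set.Iio ⟨1, Set.mem_Ioi.2 one_pos⟩ with hI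
  -- The radial measure ρ^{n-1} dρ gives (0,1) mass 1/n; this is the source of the dimension factor
  -- in the bound.
  have hνI : ν I = (n : ENNReal)⁻¹ := by
    rw [hν, hI, Measure.volumeIoiPow_apply_Iio, Nat.sub_add_cancel hnpos]
    rw [Nat.cast_sub (by omega)]
    simp only [one_pow, Nat.cast_one, sub_add_cancel, one_div]
    rw [ENNReal.ofReal_inv_of_pos (by exact_mod_cast hnpos), ENNReal.ofReal_natCast]
  have hG : Measurable fun p : Metric.sphere (0 : V) 1 × Set.Ioi (0 : ℝ) =>
      f p.1 * I.indicator (fun _ => (1 : ENNReal)) p.2 :=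
    (hf.comp measurable_fst).mul
      ((measurable_const.indicator measurableSet_Iio).comp measurable_snd)
  have h1 : ∫⁻ p, f p.1 * I.indicator (fun _ => (1 : ENNReal)) p.2
      ∂((volume : Measure V).toSphere.prod ν) ≤ ∫⁻ v : V, F v := by
    rw [← hmp.lintegral_comp hG]
    calc _ ≤ ∫⁻ v : ({0}ᶜ : Set V), F v ∂(volume.comap Subtype.val) := by
            refine lintegral_mono fun v => ?_
            by_cases hv : (homeomorphUnitSphereProd V v).2 ∈ I
            · rw [Set.indicator_of_mem hv, mul_one]
              refine (h _ _ (homeomorphUnitSphereProd V v).2.2 hv).trans (le_of_eq ?_)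
              congr 1
              have hv0 : ‖(v : V)‖ ≠ 0 := norm_ne_zero_iff.2 v.2
              simp [smul_smul, hv0]
            · rw [Set.indicator_of_notMem hv, mul_zero]
              exact zero_le
      _ ≤ ∫⁻ v : V, F v := by
            rw [lintegral_subtype_comap (measurableSet_singleton _).compl F]
            exact setLIntegral_le_lintegral _ _
  rw [lintegral_prod_mul hf.aemeasurable
    (measurable_const.indicator measurableSet_Iio).aemeasurable,
    lintegral_indicator_const measurableSet_Iio, one_mul] at h1
  rw [hνI] at h1
  calc ∫⁻ s, f s ∂((volume : Measure V).toSphere)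
      = n * ((∫⁻ s, f s ∂((volume : Measure V).toSphere)) * (n : ENNReal)⁻¹) := by
        rw [mul_comm (∫⁻ s, f s ∂_), ← mul_assoc,
          ENNReal.mul_inv_cancel (by exact_mod_cast hnpos.ne') (ENNReal.natCast_ne_top _), one_mul]
    _ ≤ _ := by gcongr

end Sphere

/-! ### Gaussian concentration on the sphere near a complex line. -/

theorem real_inner_eq_re {N : ℕ} (x y : CN N) : inner ℝ x y = (inner ℂ x y).re := by
  simp [PiLp.inner_apply, Complex.inner]

/-- The complex line spanned by `w`, as a real subspace. -/
abbrev realLine {N : ℕ} (w : CN N) : Submodule ℝ (CN N) :=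
  (Submodule.span ℂ {w}).restrictScalars ℝ

theorem starProjection_realLine {N : ℕ} (w : CN N) (hw : ‖w‖ = 1) (x : CN N) :
    (realLine w).starProjection x = inner ℂ w x • w := by
  refine Submodule.eq_starProjection_of_mem_of_inner_eq_zero ?_ ?_
  · exact Submodule.smul_mem _ _ (Submodule.mem_span_singleton_self w)
  · intro y hy
    obtain ⟨c, rfl⟩ := Submodule.mem_span_singleton.1 (show y ∈ Submodule.span ℂ {w} from hy)
    rw [real_inner_eq_re, inner_smul_right, inner_sub_left, inner_smul_left]
    simp [inner_self_eq_norm_sq_to_K, hw]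

theorem finrank_realLine {N : ℕ} (w : CN N) (hw : ‖w‖ = 1) :
    Module.finrank ℝ (realLine w) = 2 := by
  have h : Module.finrank ℝ (Submodule.span ℂ {w}) = 2 := by
    rw [finrank_real_of_complex, finrank_span_singleton (by rintro rfl; simp at hw)]
  exact h

theorem finrank_real_CN (N : ℕ) : Module.finrank ℝ (CN N) = 2 * N := by
  rw [finrank_real_of_complex, finrank_euclideanSpace_fin]

theorem norm_sub_inner_smul_sq {N : ℕ} (w : CN N) (hw : ‖w‖ = 1) (x : CN N) :
    ‖x - inner ℂ w x • w‖ ^ 2 = ‖x‖ ^ 2 - ‖(inner ℂ w x : ℂ)‖ ^ 2 := by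
  have hx : x = inner ℂ w x • w + (x - inner ℂ w x • w) := by abel
  have ho : inner ℂ (inner ℂ w x • w) (x - inner ℂ w x • w) = 0 := by
    rw [inner_smul_left, inner_sub_right, inner_smul_right]
    simp [inner_self_eq_norm_sq_to_K, hw]
  have := norm_add_sq_eq_norm_sq_add_norm_sq_of_inner_eq_zero _ _ ho
  rw [← hx, norm_smul, hw, mul_one] at this
  nlinarith

/-- Concentration of a Gaussian weight near the circle through `w` on the unit sphere. -/
theorem integral_sphere_exp_le {N : ℕ} (w : CN N) (hw : ‖w‖ = 1) {b : ℝ} (hb : 0 < b) :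
    ∫ z : Metric.sphere (0 : CN N) 1, Real.exp (-b * (1 - ‖(inner ℂ w (z : CN N) : ℂ)‖ ^ 2))
        ∂((volume : Measure (CN N)).toSphere) ≤
      2 * N * Real.exp 1 * Real.pi * (Real.pi / b) ^ (N - 1) := by
  have hw0 : w ≠ 0 := by rintro rfl; simp at hw
  have : Nontrivial (CN N) := ⟨w, 0, hw0⟩
  have hN : 1 ≤ N := by
    rcases Nat.eq_zero_or_pos N with rfl | h
    · exact absurd (Subsingleton.elim w 0) hw0
    · exact h
  have hfr : Module.finrank ℝ (realLine w)ᗮ = 2 * (N - 1) := by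
    have := (realLine w).finrank_add_finrank_orthogonal
    rw [finrank_realLine w hw, finrank_real_CN] at this
    omega
  have hc : Continuous fun z : Metric.sphere (0 : CN N) 1 =>
      Real.exp (-b * (1 - ‖(inner ℂ w (z : CN N) : ℂ)‖ ^ 2)) := by fun_prop
  rw [integral_eq_lintegral_of_nonneg_ae (.of_forall fun _ => (Real.exp_pos _).le)
    hc.aestronglyMeasurable]
  refine ENNReal.toReal_le_of_le_ofReal (by positivity) ?_
  -- The factor exp(1 - ‖Pv‖²), with P the projection to the line, is at least 1 on the unit ball.
  -- It makes the majorant integrable along the line at a cost independent of `b`.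
  have hle := lintegral_toSphere_le (V := CN N)
    (fun z => ENNReal.ofReal (Real.exp (-b * (1 - ‖(inner ℂ w (z : CN N) : ℂ)‖ ^ 2))))
    (fun v => ENNReal.ofReal (Real.exp 1) * ENNReal.ofReal
      (Real.exp (-1 * ‖(realLine w).starProjection v‖ ^ 2
        - b * ‖v - (realLine w).starProjection v‖ ^ 2)))
    (hc.measurable.ennreal_ofReal) ?_
  · refine hle.trans ?_
    rw [lintegral_const_mul' _ _ ENNReal.ofReal_ne_top,
      lintegral_exp_neg_starProjection _ one_pos hb, finrank_realLine w hw, hfr, finrank_real_CN,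
      ← ENNReal.ofReal_natCast, ← ENNReal.ofReal_mul (Real.exp_pos _).le,
      ← ENNReal.ofReal_mul (by positivity)]
    apply ENNReal.ofReal_le_ofReal
    have e : ((2 * (N - 1) : ℕ) : ℝ) / 2 = ((N - 1 : ℕ) : ℝ) := by push_cast; ring
    rw [e, Real.rpow_natCast]
    apply le_of_eq
    norm_num
    ring
  · intro s ρ h0 h1
    have hs : ‖(s : CN N)‖ = 1 := by simp
    rw [← ENNReal.ofReal_mul (Real.exp_pos _).le, ← Real.exp_add]
    apply ENNReal.ofReal_le_ofReal
    apply Real.exp_le_exp.2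
    rw [starProjection_realLine w hw, norm_sub_inner_smul_sq w hw, norm_smul, hw, mul_one,
      norm_smul, hs]
    have hi : ‖(inner ℂ w (ρ • (s : CN N)) : ℂ)‖ = ρ * ‖(inner ℂ w (s : CN N) : ℂ)‖ := by
      rw [← Complex.coe_smul, inner_smul_right, norm_mul, Complex.norm_real, Real.norm_of_nonneg h0.le]
    rw [hi, Real.norm_of_nonneg h0.le]
    have hcs : ‖(inner ℂ w (s : CN N) : ℂ)‖ ≤ 1 := by
      simpa [hw, hs] using norm_inner_le_norm (𝕜 := ℂ) w (s : CN N)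
    set y := ‖(inner ℂ w (s : CN N) : ℂ)‖
    have hy : 0 ≤ y := norm_nonneg _
    have h2 : ρ ^ 2 ≤ 1 := by nlinarith
    have h3 : y ^ 2 ≤ 1 := by nlinarith
    have h4 : ρ ^ 2 * y ^ 2 ≤ 1 := by nlinarith [sq_nonneg y]
    have h5 : 0 ≤ b * ((1 - y ^ 2) * (1 - ρ ^ 2)) :=
      mul_nonneg hb.le (mul_nonneg (by linarith) (by linarith))
    nlinarith

/-! ### The quadratic exponent: coercivity and local Lipschitz bound. -/

theorem hermPair_eq_inner {N : ℕ} (z w : CN N) : hermPair z w = inner ℂ w z := by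
  simp [hermPair, PiLp.inner_apply]

/-- The exponent `Q_A(v)/2 - |v|²/2` of a squeezed Gaussian. -/
def gaussExponent {N : ℕ} (A : Matrix (Fin N) (Fin N) ℂ) (v : CN N) : ℂ :=
  quadForm A v / 2 - ((‖v‖ ^ 2 : ℝ) : ℂ) / 2

theorem continuous_quadForm {N : ℕ} (A : Matrix (Fin N) (Fin N) ℂ) : Continuous (quadForm A) := by
  unfold quadForm
  fun_prop

theorem continuous_gaussExponent {N : ℕ} (A : Matrix (Fin N) (Fin N) ℂ) :
    Continuous (gaussExponent A) := by
  unfold gaussExponent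
  have := continuous_quadForm A
  fun_prop

theorem quadForm_smul {N : ℕ} (A : Matrix (Fin N) (Fin N) ℂ) (c : ℂ) (v : CN N) :
    quadForm A (c • v) = c ^ 2 * quadForm A v := by
  simp only [quadForm, Finset.mul_sum, PiLp.smul_apply, smul_eq_mul]
  refine Finset.sum_congr rfl fun i _ => Finset.sum_congr rfl fun j _ => by ring

theorem gaussExponent_real_smul {N : ℕ} (A : Matrix (Fin N) (Fin N) ℂ) (c : ℝ) (v : CN N) :
    gaussExponent A ((c : ℂ) • v) = (c : ℂ) ^ 2 * gaussExponent A v := by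
  rw [gaussExponent, gaussExponent, quadForm_smul, norm_smul, Complex.norm_real, mul_pow,
    Real.norm_eq_abs, sq_abs]
  push_cast
  ring

/-- A matrix of the generalized disk shrinks nonzero vectors strictly. -/
theorem norm_quadForm_lt {N : ℕ} {A : Matrix (Fin N) (Fin N) ℂ} (hA : A ∈ genDisk N)
    (v : CN N) (hv : v ≠ 0) : ‖quadForm A v‖ < ‖v‖ ^ 2 := by
  set y : CN N := WithLp.toLp 2 (A *ᵥ v.ofLp) with hy
  set x : CN N := WithLp.toLp 2 (star v.ofLp) with hx
  have hxn : ‖x‖ = ‖v‖ := by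
    simp [hx, EuclideanSpace.norm_eq]
  -- Q_A(v) is the Hermitian pairing of conj v with Av, so Cauchy–Schwarz reduces the claim to |Av|
  -- < |v|.
  have hq : quadForm A v = inner ℂ x y := by
    simp only [quadForm, PiLp.inner_apply, hx, hy, Matrix.mulVec, dotProduct]
    refine Finset.sum_congr rfl fun i _ => ?_
    simp [Finset.mul_sum, mul_comm, mul_left_comm, mul_assoc]
  have hyn : ‖y‖ < ‖v‖ := by
    have h0 : v.ofLp ≠ 0 := by simpa using hv
    have h := hA.2.dotProduct_mulVec_pos h0
    rw [Matrix.sub_mulVec, Matrix.one_mulVec, dotProduct_sub, ← Matrix.mulVec_mulVec,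
      Matrix.dotProduct_mulVec, ← Matrix.star_mulVec] at h
    have e1 : star v.ofLp ⬝ᵥ v.ofLp = ((‖v‖ ^ 2 : ℝ) : ℂ) := by
      have := inner_self_eq_norm_sq_to_K (𝕜 := ℂ) v
      rw [EuclideanSpace.inner_eq_star_dotProduct, dotProduct_comm] at this
      rw [this]; norm_num
    have e2 : star (A *ᵥ v.ofLp) ⬝ᵥ (A *ᵥ v.ofLp) = ((‖y‖ ^ 2 : ℝ) : ℂ) := by
      have := inner_self_eq_norm_sq_to_K (𝕜 := ℂ) y
      rw [EuclideanSpace.inner_eq_star_dotProduct, dotProduct_comm] at this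
      rw [this]; norm_num
    rw [e1, e2, ← Complex.ofReal_sub, Complex.zero_lt_real] at h
    exact lt_of_pow_lt_pow_left₀ 2 (norm_nonneg _) (by linarith)
  rw [hq]
  calc ‖(inner ℂ x y : ℂ)‖ ≤ ‖x‖ * ‖y‖ := norm_inner_le_norm _ _
    _ < ‖v‖ ^ 2 := by
      rw [hxn, sq]
      exact mul_lt_mul_of_pos_left hyn (norm_pos_iff.2 hv)

/-- Compactness of the unit sphere makes the strict inequality |Q_A(v)| < |v|² uniform, and
homogeneity extends it to all vectors. The empty sphere (N = 0) is treated apart. -/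
theorem exists_re_gaussExponent_le {N : ℕ} {A : Matrix (Fin N) (Fin N) ℂ} (hA : A ∈ genDisk N) :
    ∃ c > 0, ∀ v : CN N, (gaussExponent A v).re ≤ -c * ‖v‖ ^ 2 := by
  by_cases hne : (Metric.sphere (0 : CN N) 1).Nonempty
  · obtain ⟨u, hu, hmax⟩ := (isCompact_sphere (0 : CN N) 1).exists_isMaxOn hne
      (continuous_quadForm A).norm.continuousOn
    have hu1 : ‖u‖ = 1 := by simpa using hu
    have hlt := norm_quadForm_lt hA u (by rintro rfl; simp at hu1)
    rw [hu1, one_pow] at hlt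
    refine ⟨(1 - ‖quadForm A u‖) / 2, by linarith, fun v => ?_⟩
    have hb : ‖quadForm A v‖ ≤ ‖quadForm A u‖ * ‖v‖ ^ 2 := by
      by_cases hv : v = 0
      · subst hv
        simp [quadForm]
      · have hv' : ‖v‖ ≠ 0 := norm_ne_zero_iff.2 hv
        have h1 := hmax (show ((‖v‖⁻¹ : ℝ) : ℂ) • v ∈ Metric.sphere (0 : CN N) 1 by
          simp [norm_smul, hv'])
        have h2 : v = (‖v‖ : ℂ) • (((‖v‖⁻¹ : ℝ) : ℂ) • v) := by
          rw [smul_smul, ← Complex.ofReal_mul, mul_inv_cancel₀ hv', Complex.ofReal_one, one_smul]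
        conv_lhs => rw [h2]
        rw [quadForm_smul, norm_mul, norm_pow, Complex.norm_real, norm_norm, mul_comm]
        exact mul_le_mul_of_nonneg_right h1 (sq_nonneg _)
    have h3 : (gaussExponent A v).re = (quadForm A v).re / 2 - ‖v‖ ^ 2 / 2 := by
      simp only [gaussExponent, Complex.sub_re, Complex.div_ofNat_re, Complex.ofReal_re]
    rw [h3]
    nlinarith [Complex.re_le_norm (quadForm A v)]
  · refine ⟨1, one_pos, fun v => ?_⟩
    have hv : v = 0 := by
      by_contra hv
      exact hne ⟨((‖v‖⁻¹ : ℝ) : ℂ) • v, by simp [norm_smul, norm_ne_zero_iff.2 hv]⟩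
    subst hv
    simp [gaussExponent, quadForm]

theorem norm_bilin_le {N : ℕ} (A : Matrix (Fin N) (Fin N) ℂ) (x y : CN N) :
    ‖∑ i, ∑ j, x i * A i j * y j‖ ≤ (∑ i, ∑ j, ‖A i j‖) * (‖x‖ * ‖y‖) := by
  rw [Finset.sum_mul]
  refine norm_sum_le_of_le _ fun i _ => ?_
  rw [Finset.sum_mul]
  refine norm_sum_le_of_le _ fun j _ => ?_
  rw [norm_mul, norm_mul]
  have h1 := PiLp.norm_apply_le x i
  have h2 := PiLp.norm_apply_le y j
  calc ‖x i‖ * ‖A i j‖ * ‖y j‖ = ‖A i j‖ * (‖x i‖ * ‖y j‖) := by ring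
    _ ≤ _ := by gcongr

/-- The factor ‖u‖ + ‖v‖ is what turns a second-order error in the argument into a third-order error
in the exponent. -/
theorem exists_norm_gaussExponent_sub_le {N : ℕ} (A : Matrix (Fin N) (Fin N) ℂ) :
    ∃ K > 0, ∀ u v : CN N,
      ‖gaussExponent A u - gaussExponent A v‖ ≤ K * ((‖u‖ + ‖v‖) * ‖u - v‖) := by
  set M := ∑ i, ∑ j, ‖A i j‖ with hM
  have hM0 : 0 ≤ M := Finset.sum_nonneg fun i _ => Finset.sum_nonneg fun j _ => norm_nonneg _
  refine ⟨M / 2 + 1 / 2, by positivity, fun u v => ?_⟩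
  have hq : quadForm A u - quadForm A v =
      (∑ i, ∑ j, u i * A i j * (u - v) j) + ∑ i, ∑ j, (u - v) i * A i j * v j := by
    simp only [quadForm, ← Finset.sum_sub_distrib, ← Finset.sum_add_distrib, PiLp.sub_apply]
    refine Finset.sum_congr rfl fun i _ => Finset.sum_congr rfl fun j _ => by ring
  have h1 : ‖quadForm A u - quadForm A v‖ ≤ M * ((‖u‖ + ‖v‖) * ‖u - v‖) := by
    rw [hq]
    refine (norm_add_le _ _).trans ((add_le_add (norm_bilin_le A _ _) (norm_bilin_le A _ _)).trans ?_)
    rw [← hM]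
    apply le_of_eq
    ring
  have h2 : |‖u‖ ^ 2 - ‖v‖ ^ 2| ≤ (‖u‖ + ‖v‖) * ‖u - v‖ := by
    rw [sq_sub_sq, abs_mul, abs_of_nonneg (by positivity)]
    gcongr
    exact abs_norm_sub_norm_le u v
  have h3 : gaussExponent A u - gaussExponent A v =
      (quadForm A u - quadForm A v) / 2 - ((‖u‖ ^ 2 - ‖v‖ ^ 2 : ℝ) : ℂ) / 2 := by
    simp only [gaussExponent]
    push_cast
    ring
  rw [h3]
  refine (norm_sub_le _ _).trans ?_
  rw [norm_div, norm_div, Complex.norm_real, Real.norm_eq_abs]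
  norm_num
  linarith

/-! ### The integrand as one exponential, and elementary inequalities. -/

/-- The lifted state in terms of the exponent, at unit base point. -/
theorem exp_mul_gaussianState {N : ℕ} (k : ℕ) (A : Matrix (Fin N) (Fin N) ℂ) (w z : CN N)
    (hw : ‖w‖ = 1) (t : ℝ) :
    Complex.exp (-(Complex.I * (k : ℂ) * (t : ℂ))) *
        gaussianState k A w (Complex.exp (Complex.I * (t : ℂ)) • z) =
      Complex.exp ((k : ℂ) * (gaussExponent A (Complex.exp (Complex.I * t) • z - w) +
        Complex.I * (((Complex.exp (Complex.I * t) * inner ℂ w z).im - t : ℝ) : ℂ))) := by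
  set y := Complex.exp (Complex.I * (t : ℂ)) • z with hy
  have hin : Complex.exp (Complex.I * t) * inner ℂ w z = inner ℂ w y := by
    rw [hy, inner_smul_right]
  -- Expanding the square absorbs Re⟨w,y⟩ into the exponent, so only Im⟨w,y⟩ survives as an
  -- oscillating phase.
  have hn : ((‖y - w‖ ^ 2 : ℝ) : ℂ) =
      ((‖y‖ ^ 2 : ℝ) : ℂ) - 2 * (((inner ℂ w y : ℂ).re : ℝ) : ℂ) + 1 := by
    have := norm_sub_sq (𝕜 := ℂ) y w
    rw [this, hw, inner_re_symm]
    push_cast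
    simp
  have hre : (inner ℂ w y : ℂ) =
      (((inner ℂ w y : ℂ).re : ℝ) : ℂ) + (((inner ℂ w y : ℂ).im : ℝ) : ℂ) * Complex.I :=
    (Complex.re_add_im _).symm
  rw [hin, gaussianState, gaussExponent, hn, hermPair_eq_inner, hw, ← Complex.exp_add,
    ← Complex.exp_add, ← Complex.exp_add, ← Complex.exp_add]
  congr 1
  generalize (inner ℂ w y : ℂ).re = a at *
  generalize (inner ℂ w y : ℂ).im = b at *
  rw [hre]
  push_cast
  ring

/-- Mean value inequality on a convex half-plane; a common Gaussian bound on both exponentials is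
inherited by their difference. -/
theorem norm_exp_sub_exp_le {X Y : ℂ} {m : ℝ} (hX : X.re ≤ m) (hY : Y.re ≤ m) :
    ‖Complex.exp X - Complex.exp Y‖ ≤ Real.exp m * ‖X - Y‖ := by
  refine Convex.norm_image_sub_le_of_norm_hasDerivWithin_le (f' := Complex.exp)
    (s := {z : ℂ | z.re ≤ m}) (fun x _ => (Complex.hasDerivAt_exp x).hasDerivWithinAt)
    (fun x hx => ?_) (convex_halfSpace_re_le m) hY hX
  rw [Complex.norm_exp]
  exact Real.exp_le_exp.2 hx

/-- Taylor's bound serves for |t| ≤ 1 and a trivial bound otherwise; the crude constant buys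
validity for every t. -/
theorem abs_sin_sub_self_le (t : ℝ) : |Real.sin t - t| ≤ 2 * |t| ^ 3 := by
  rcases le_total |t| 1 with h | h
  · have h1 := Real.sin_bound h
    have h2 : |Real.sin t - t| ≤ |Real.sin t - (t - t ^ 3 / 6)| + |t ^ 3 / 6| := by
      have : Real.sin t - t = (Real.sin t - (t - t ^ 3 / 6)) - t ^ 3 / 6 := by ring
      rw [this]
      exact abs_sub _ _
    rw [abs_div, abs_pow, abs_of_pos (by norm_num : (0 : ℝ) < 6)] at h2
    have h3 : |t| ^ 5 ≤ |t| ^ 3 := pow_le_pow_of_le_one (abs_nonneg _) h (by norm_num)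
    nlinarith [pow_nonneg (abs_nonneg t) 3]
  · have h1 : |Real.sin t - t| ≤ |Real.sin t| + |t| := abs_sub _ _
    have h2 := Real.abs_sin_le_one t
    have h3 : |t| ^ 1 ≤ |t| ^ 3 := pow_le_pow_right₀ h (by norm_num)
    rw [pow_one] at h3
    linarith

theorem norm_exp_I_mul_sub_one_sub_le (t : ℝ) :
    ‖Complex.exp (Complex.I * t) - 1 - Complex.I * t‖ ≤ 2 * |t| ^ 2 := by
  have hn : ‖Complex.I * (t : ℂ)‖ = |t| := by simp
  rcases le_total |t| 1 with h | h
  · have := Complex.norm_exp_sub_one_sub_id_le (x := Complex.I * t) (by rw [hn]; exact h)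
    rw [hn] at this
    nlinarith [sq_nonneg |t|]
  · have h1 := norm_sub_le (Complex.exp (Complex.I * t) - 1) (Complex.I * t)
    have h2 := Real.norm_exp_I_mul_ofReal_sub_one_le (x := t)
    rw [hn] at h1
    rw [Real.norm_eq_abs] at h2
    nlinarith

/-- The right side is (r-1)² + 2r(1 - cos t), with 2r ≥ 1 and 1 - cos t ≥ 2t²/π² on [-π, π].
Gaussian decay in t thus holds on the whole circle, with no cutoff near t = 0. -/
theorem two_div_pi_sq_mul_sq_le {t r : ℝ} (ht : |t| ≤ Real.pi) (hr : 1 / 2 ≤ r) :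
    2 / Real.pi ^ 2 * t ^ 2 ≤ ‖Complex.exp (Complex.I * t) * (r : ℂ) - 1‖ ^ 2 := by
  have h := Real.cos_le_one_sub_mul_cos_sq ht
  have e : ‖Complex.exp (Complex.I * t) * (r : ℂ) - 1‖ ^ 2 =
      (r - 1) ^ 2 + 2 * r * (1 - Real.cos t) := by
    rw [← Complex.normSq_eq_norm_sq, Complex.normSq_apply, mul_comm Complex.I]
    simp [Complex.exp_ofReal_mul_I_re, Complex.exp_ofReal_mul_I_im]
    nlinarith [Real.sin_sq_add_cos_sq t]
  rw [e]
  have := Real.cos_le_one t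
  nlinarith [sq_nonneg (r - 1)]

/-! ### The phase, circle equivariance, and the integral centred at t = 0. -/

/-- The Gaussian integral along the circle direction that computes the symbol. -/
def symbolIntegral {N : ℕ} (A : Matrix (Fin N) (Fin N) ℂ) (w η : CN N) : ℂ :=
  1 / (2 * (Real.pi : ℂ)) *
    ∫ t : ℝ, Complex.exp (gaussExponent A ((Complex.I * (t : ℂ)) • w + η))

/-- The phase of the integrand of a reduced state. -/
def reducedPhase {N : ℕ} (A : Matrix (Fin N) (Fin N) ℂ) (w z : CN N) (t : ℝ) : ℂ :=
  gaussExponent A (Complex.exp (Complex.I * t) • z - w) +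
    Complex.I * (((Complex.exp (Complex.I * t) * inner ℂ w z).im - t : ℝ) : ℂ)

theorem reducedPhase_re {N : ℕ} (A : Matrix (Fin N) (Fin N) ℂ) (w z : CN N) (t : ℝ) :
    (reducedPhase A w z t).re = (gaussExponent A (Complex.exp (Complex.I * t) • z - w)).re := by
  simp only [reducedPhase, Complex.add_re, Complex.I_mul_re, Complex.ofReal_im, neg_zero, add_zero]

theorem norm_exp_I_mul (t : ℝ) : ‖Complex.exp (Complex.I * t)‖ = 1 := by
  rw [mul_comm]
  exact Complex.norm_exp_ofReal_mul_I t

theorem periodic_reduction_integrand {N : ℕ} (k : ℕ) (ψ : CN N → ℂ) (z : CN N) :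
    Function.Periodic (fun t : ℝ => Complex.exp (-(Complex.I * (k : ℂ) * (t : ℂ))) *
      ψ (Complex.exp (Complex.I * (t : ℂ)) • z)) (2 * Real.pi) := by
  intro t
  have h1 : Complex.exp (Complex.I * ((t + 2 * Real.pi : ℝ) : ℂ)) = Complex.exp (Complex.I * t) := by
    rw [← Complex.exp_periodic (Complex.I * t)]
    congr 1
    push_cast
    ring
  have h2 : Complex.exp (-(Complex.I * (k : ℂ) * ((t + 2 * Real.pi : ℝ) : ℂ))) =
      Complex.exp (-(Complex.I * (k : ℂ) * (t : ℂ))) := by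
    rw [← Complex.exp_periodic.sub_nat_mul_eq k (x := -(Complex.I * (k : ℂ) * (t : ℂ)))]
    congr 1
    push_cast
    ring
  simp only [h1, h2]

/-- A reduced function has weight `k` under the circle action. -/
theorem reduction_exp_smul {N : ℕ} (k : ℕ) (ψ : CN N → ℂ) (z : CN N) (θ : ℝ) :
    reduction k ψ (Complex.exp (Complex.I * θ) • z) =
      Complex.exp (Complex.I * k * θ) * reduction k ψ z := by
  set g := fun t : ℝ => Complex.exp (-(Complex.I * (k : ℂ) * (t : ℂ))) *
      ψ (Complex.exp (Complex.I * (t : ℂ)) • z) with hg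
  have h1 : ∀ t : ℝ, Complex.exp (-(Complex.I * (k : ℂ) * (t : ℂ))) *
      ψ (Complex.exp (Complex.I * (t : ℂ)) • Complex.exp (Complex.I * θ) • z) =
      Complex.exp (Complex.I * k * θ) * g (t + θ) := by
    intro t
    simp only [hg]
    rw [smul_smul, ← Complex.exp_add, ← mul_assoc, ← Complex.exp_add]
    congr 2
    · push_cast
      ring
    · push_cast
      ring_nf
  have h2 : ∫ t in (0 : ℝ)..(2 * Real.pi), g (t + θ) = ∫ t in (0 : ℝ)..(2 * Real.pi), g t := by
    rw [intervalIntegral.integral_comp_add_right, zero_add, add_comm (2 * Real.pi) θ,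
      (periodic_reduction_integrand k ψ z).intervalIntegral_add_eq θ 0, zero_add]
  rw [reduction, reduction]
  simp only [h1]
  rw [intervalIntegral.integral_const_mul, h2]
  ring

/-- Periodicity puts the critical point t = 0 inside the interval; extension by zero allows
comparison with a Gaussian integral over ℝ. -/
theorem reducedState_eq_integral {N : ℕ} (k : ℕ) (A : Matrix (Fin N) (Fin N) ℂ) (w z : CN N)
    (hw : ‖w‖ = 1) :
    reducedState k A w z = 1 / (2 * (Real.pi : ℂ)) *
      ∫ t : ℝ, (Set.Ioc (-Real.pi) Real.pi).indicator
        (fun t => Complex.exp ((k : ℂ) * reducedPhase A w z t)) t := by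
  have hp := (periodic_reduction_integrand k (gaussianState k A w) z).intervalIntegral_add_eq
    0 (-Real.pi)
  rw [zero_add, show -Real.pi + 2 * Real.pi = Real.pi by ring] at hp
  rw [reducedState, reduction, hp, intervalIntegral.integral_of_le (by linarith [Real.pi_pos]),
    integral_indicator measurableSet_Ioc]
  simp only [exp_mul_gaussianState k A w z hw, reducedPhase]

theorem continuous_reducedPhase {N : ℕ} (A : Matrix (Fin N) (Fin N) ℂ) (w z : CN N) :
    Continuous (reducedPhase A w z) := by
  unfold reducedPhase
  have := continuous_gaussExponent A
  fun_prop

theorem norm_smul_add_sq {N : ℕ} {w ζ : CN N} (hw : ‖w‖ = 1) (hζ : inner ℂ w ζ = 0) (a b : ℂ)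
    (hb : ‖b‖ = 1) : ‖a • w + b • ζ‖ ^ 2 = ‖a‖ ^ 2 + ‖ζ‖ ^ 2 := by
  have ho : inner ℂ (a • w) (b • ζ) = 0 := by
    rw [inner_smul_left, inner_smul_right, hζ]; simp
  have := norm_add_sq_eq_norm_sq_add_norm_sq_of_inner_eq_zero _ _ ho
  rw [norm_smul, norm_smul, hw, hb] at this
  nlinarith

/-- Half of the Gaussian rate pays for the cubic factor, through y³ ≤ 1 + y⁴ and x²/2 ≤ eˣ at x =
cy²/2. -/
theorem cube_mul_exp_le {c : ℝ} (hc : 0 < c) (y : ℝ) :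
    y ^ 3 * Real.exp (-c * y ^ 2) ≤ (1 + 8 / c ^ 2) * Real.exp (-(c / 2) * y ^ 2) := by
  have h1 := Real.quadratic_le_exp_of_nonneg (x := c / 2 * y ^ 2) (by positivity)
  have h2 : y ^ 3 ≤ 1 + y ^ 4 := by nlinarith [sq_nonneg (y ^ 2 - y), sq_nonneg (y - 1), sq_nonneg (y ^ 2 - 1)]
  have h3 : y ^ 4 ≤ 8 / c ^ 2 * Real.exp (c / 2 * y ^ 2) := by
    rw [div_mul_eq_mul_div, le_div_iff₀ (by positivity)]
    nlinarith [mul_nonneg hc.le (sq_nonneg y)]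
  have h4 : 1 ≤ Real.exp (c / 2 * y ^ 2) := Real.one_le_exp (by positivity)
  have h5 : Real.exp (-c * y ^ 2) = Real.exp (-(c / 2) * y ^ 2) * (Real.exp (c / 2 * y ^ 2))⁻¹ := by
    rw [← Real.exp_neg, ← Real.exp_add]; ring_nf
  have h6 : y ^ 3 * (Real.exp (c / 2 * y ^ 2))⁻¹ ≤ 1 + 8 / c ^ 2 := by
    rw [← div_eq_mul_inv, div_le_iff₀ (by positivity)]
    linarith
  rw [h5]
  calc _ = y ^ 3 * (Real.exp (c / 2 * y ^ 2))⁻¹ * Real.exp (-(c / 2) * y ^ 2) := by ring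
    _ ≤ _ := by gcongr

/-! ### Cubic phase error and domination of the integrand. -/

/-- The phase agrees with its quadratic part up to a cubic error. -/
theorem exists_norm_reducedPhase_sub_le {N : ℕ} (A : Matrix (Fin N) (Fin N) ℂ) (w : CN N)
    (hw : ‖w‖ = 1) :
    ∃ K ≥ 1, ∀ (ζ : CN N) (r t s : ℝ), inner ℂ w ζ = 0 → 1 / 2 ≤ r → r ≤ 1 → 1 - r ≤ ‖ζ‖ ^ 2 →
      0 ≤ s → s ^ 2 = t ^ 2 + ‖ζ‖ ^ 2 →
      ‖reducedPhase A w ((r : ℂ) • w + ζ) t - gaussExponent A ((Complex.I * (t : ℂ)) • w + ζ)‖ ≤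
        K * s ^ 3 := by
  obtain ⟨K, hK, hlip⟩ := exists_norm_gaussExponent_sub_le A
  -- 16K is K(3 + 1)·4 from the Lipschitz bound below, and 3 bounds the error r sin t - t.
  refine ⟨16 * K + 3, by linarith, fun ζ r t s hζ hr hr1 hrζ hs hst => ?_⟩
  set e := Complex.exp (Complex.I * t) with he
  have hen : ‖e‖ = 1 := norm_exp_I_mul t
  have hts : |t| ≤ s := abs_le_of_sq_le_sq (by nlinarith [sq_nonneg ‖ζ‖]) hs
  have hζs : ‖ζ‖ ≤ s := le_of_sq_le_sq (by nlinarith [sq_nonneg t]) hs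
  have hr2 : 1 - r ≤ ‖ζ‖ := by
    rcases le_total ‖ζ‖ 1 with h | h
    · nlinarith [norm_nonneg ζ]
    · linarith
  have he1 : ‖e - 1‖ ≤ |t| := Real.norm_exp_I_mul_ofReal_sub_one_le
  have he2 : ‖e - 1 - Complex.I * t‖ ≤ 2 * |t| ^ 2 := norm_exp_I_mul_sub_one_sub_le t
  have hrn : ‖((r : ℂ) - 1)‖ = 1 - r := by
    rw [← Complex.ofReal_one, ← Complex.ofReal_sub, Complex.norm_real, Real.norm_eq_abs,
      abs_of_nonpos (by linarith)]
    ring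
  set u := e • ((r : ℂ) • w + ζ) - w with hu
  set u0 := (Complex.I * (t : ℂ)) • w + ζ with hu0
  have hu0n : ‖u0‖ = s := by
    have := norm_smul_add_sq hw hζ (Complex.I * (t : ℂ)) 1 (by simp)
    rw [one_smul, ← hu0, norm_mul, Complex.norm_I, one_mul, Complex.norm_real, Real.norm_eq_abs,
      sq_abs, ← hst] at this
    exact (sq_eq_sq₀ (norm_nonneg _) hs).1 this
  have hun : ‖u‖ ≤ 3 * s := by
    have : u = (e - 1) • w + (e * ((r : ℂ) - 1)) • w + e • ζ := by
      rw [hu]; module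
    rw [this]
    refine (norm_add₃_le).trans ?_
    rw [norm_smul, norm_smul, norm_smul, norm_mul, hen, hw, hrn]
    linarith
  -- All three pieces are of second order: 2t², 1 - r ≤ ‖ζ‖², and |t|‖ζ‖.
  have hd : ‖u - u0‖ ≤ 4 * s ^ 2 := by
    have : u - u0 = (e - 1 - Complex.I * t) • w + (e * ((r : ℂ) - 1)) • w + (e - 1) • ζ := by
      rw [hu, hu0]; module
    rw [this]
    refine (norm_add₃_le).trans ?_
    rw [norm_smul, norm_smul, norm_smul, norm_mul, hen, hw, hrn]
    have h1 : ‖e - 1‖ * ‖ζ‖ ≤ |t| * ‖ζ‖ := by gcongr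
    have h2 : 2 * (|t| * ‖ζ‖) ≤ |t| ^ 2 + ‖ζ‖ ^ 2 := by nlinarith [sq_nonneg (|t| - ‖ζ‖)]
    rw [sq_abs] at h2 he2
    nlinarith [sq_nonneg t, sq_nonneg ‖ζ‖]
  have him : (e * inner ℂ w ((r : ℂ) • w + ζ)).im = r * Real.sin t := by
    rw [inner_add_right, inner_smul_right, hζ, inner_self_eq_norm_sq_to_K, hw, he,
      mul_comm Complex.I]
    simp [Complex.exp_ofReal_mul_I_im, Complex.exp_ofReal_mul_I_re]
    ring
  have hsin : |r * Real.sin t - t| ≤ 3 * s ^ 3 := by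
    have h1 : r * Real.sin t - t = r * (Real.sin t - t) - (1 - r) * t := by ring
    have h2 := abs_sub (r * (Real.sin t - t)) ((1 - r) * t)
    rw [← h1, abs_mul, abs_mul, abs_of_nonneg (by linarith : 0 ≤ r),
      abs_of_nonneg (by linarith : 0 ≤ 1 - r)] at h2
    have h3 := abs_sin_sub_self_le t
    have h4 : |t| ^ 3 ≤ s ^ 3 := by gcongr
    have h5 : (1 - r) * |t| ≤ s ^ 2 * s := by
      gcongr
      nlinarith [sq_nonneg t]
    have h6 : r * |Real.sin t - t| ≤ 1 * |Real.sin t - t| := by gcongr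
    nlinarith
  rw [reducedPhase, him, add_sub_right_comm]
  refine (norm_add_le _ _).trans ?_
  rw [norm_mul, Complex.norm_I, one_mul, Complex.norm_real, Real.norm_eq_abs]
  have h7 : ‖gaussExponent A u - gaussExponent A u0‖ ≤ K * ((3 * s + s) * (4 * s ^ 2)) := by
    refine (hlip u u0).trans ?_
    rw [hu0n]
    gcongr
  nlinarith

/-- Uniform Gaussian domination of the error in the quadratic approximation of the phase. -/
theorem exists_norm_integrand_sub_le {N : ℕ} {A : Matrix (Fin N) (Fin N) ℂ} (hA : A ∈ genDisk N)
    (w : CN N) (hw : ‖w‖ = 1) :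
    ∃ C > 0, ∃ c > 0, ∀ (k : ℕ) (ζ : CN N) (r t : ℝ), 0 < k → inner ℂ w ζ = 0 → 1 / 2 ≤ r →
      r ≤ 1 → 1 - r ≤ ‖ζ‖ ^ 2 →
      ‖(Set.Ioc (-Real.pi) Real.pi).indicator
          (fun t => Complex.exp ((k : ℂ) * reducedPhase A w ((r : ℂ) • w + ζ) t)) t -
        Complex.exp ((k : ℂ) * gaussExponent A ((Complex.I * (t : ℂ)) • w + ζ))‖ ≤
        C * (√(k : ℝ))⁻¹ * Real.exp (-c * k * (t ^ 2 + ‖ζ‖ ^ 2)) := by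
  obtain ⟨c₁, hc₁, hE⟩ := exists_re_gaussExponent_le hA
  obtain ⟨K, hK, hphase⟩ := exists_norm_reducedPhase_sub_le A w hw
  set c := c₁ * (2 / Real.pi ^ 2) with hc
  have hpi := Real.pi_gt_three
  have hc0 : 0 < c := by positivity
  have hcc : c ≤ c₁ := by
    have : 2 / Real.pi ^ 2 ≤ 1 := by
      rw [div_le_one (by positivity)]; nlinarith
    calc c ≤ c₁ * 1 := by rw [hc]; gcongr
      _ = c₁ := mul_one _
  refine ⟨K * (1 + 8 / c ^ 2), by positivity, c / 2, by positivity,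
    fun k ζ r t hk hζ hr hr1 hrζ => ?_⟩
  have hk1 : (1 : ℝ) ≤ k := by exact_mod_cast hk
  set s := √(t ^ 2 + ‖ζ‖ ^ 2) with hs
  have hs0 : 0 ≤ s := Real.sqrt_nonneg _
  have hst : s ^ 2 = t ^ 2 + ‖ζ‖ ^ 2 := Real.sq_sqrt (by positivity)
  have hre : ∀ X : ℂ, ((k : ℂ) * X).re = k * X.re := fun X => by simp
  have hu0 : (gaussExponent A ((Complex.I * (t : ℂ)) • w + ζ)).re ≤ -c * s ^ 2 := by
    refine (hE _).trans ?_
    have := norm_smul_add_sq hw hζ (Complex.I * (t : ℂ)) 1 (by simp)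
    rw [one_smul, norm_mul, Complex.norm_I, one_mul, Complex.norm_real, Real.norm_eq_abs,
      sq_abs, ← hst] at this
    rw [this]
    nlinarith [sq_nonneg s]
  have key : ‖(Set.Ioc (-Real.pi) Real.pi).indicator
        (fun t => Complex.exp ((k : ℂ) * reducedPhase A w ((r : ℂ) • w + ζ) t)) t -
      Complex.exp ((k : ℂ) * gaussExponent A ((Complex.I * (t : ℂ)) • w + ζ))‖ ≤
      Real.exp (k * (-c * s ^ 2)) * (k * (K * s ^ 3)) := by
    by_cases ht : t ∈ Set.Ioc (-Real.pi) Real.pi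
    · rw [Set.indicator_of_mem ht]
      refine (norm_exp_sub_exp_le (m := k * (-c * s ^ 2)) ?_ ?_).trans ?_
      · rw [hre]
        refine mul_le_mul_of_nonneg_left ?_ (by positivity)
        rw [reducedPhase_re]
        refine (hE _).trans ?_
        have h1 : Complex.exp (Complex.I * t) • ((r : ℂ) • w + ζ) - w =
            (Complex.exp (Complex.I * t) * (r : ℂ) - 1) • w + Complex.exp (Complex.I * t) • ζ := by
          module
        rw [h1, norm_smul_add_sq hw hζ _ _ (norm_exp_I_mul t)]
        have h2 := two_div_pi_sq_mul_sq_le (abs_le.2 ⟨ht.1.le, ht.2⟩) hr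
        have h3 := mul_le_mul_of_nonneg_left h2 hc₁.le
        have h4 := mul_le_mul_of_nonneg_right hcc (sq_nonneg ‖ζ‖)
        rw [hst, hc]
        rw [hc] at h4
        linarith
      · rw [hre]
        exact mul_le_mul_of_nonneg_left hu0 (by positivity)
      · rw [← mul_sub, norm_mul, Complex.norm_natCast]
        gcongr
        exact hphase ζ r t s hζ hr hr1 hrζ hs0 hst
    · rw [Set.indicator_of_notMem ht, zero_sub, norm_neg, Complex.norm_exp, hre]
      -- Off the interval only the Gaussian remains. There s ≥ 1, so the prefactor kKs³ is at least
      -- 1; this is why K ≥ 1 was required.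
      have hpt : 1 ≤ t ^ 2 := by
        by_contra! h
        have := abs_lt_of_sq_lt_sq (by linarith : t ^ 2 < 1 ^ 2) (by norm_num)
        exact ht ⟨by linarith [(abs_lt.1 this).1], by linarith [(abs_lt.1 this).2]⟩
      have hs1 : 1 ≤ s := by
        rw [hs]
        exact Real.one_le_sqrt.2 (by nlinarith [sq_nonneg ‖ζ‖])
      have h1 : 1 ≤ (k : ℝ) * (K * s ^ 3) :=
        one_le_mul_of_one_le_of_one_le hk1
          (one_le_mul_of_one_le_of_one_le hK (one_le_pow₀ hs1))
      calc _ ≤ Real.exp (k * (-c * s ^ 2)) :=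
            Real.exp_le_exp.2 (mul_le_mul_of_nonneg_left hu0 (by positivity))
        _ ≤ _ := le_mul_of_one_le_right (Real.exp_pos _).le h1
  refine key.trans ?_
  have hsk : √(k : ℝ) ^ 2 = k := Real.sq_sqrt (by positivity)
  have hsk0 : 0 < √(k : ℝ) := Real.sqrt_pos.2 (by positivity)
  have h8 := cube_mul_exp_le hc0 (√(k : ℝ) * s)
  rw [mul_pow, mul_pow, hsk] at h8
  rw [← hst]
  -- In the scaled variable √k s the cubic error k s³ carries a factor k^{-1/2}.
  have h9 : (k : ℝ) * (K * s ^ 3) = K * (√(k : ℝ))⁻¹ * (√(k : ℝ) ^ 3 * s ^ 3) := by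
    field_simp
    rw [hsk]
    ring
  calc Real.exp (k * (-c * s ^ 2)) * (k * (K * s ^ 3))
      = K * (√(k : ℝ))⁻¹ * (√(k : ℝ) ^ 3 * s ^ 3 * Real.exp (-c * (k * s ^ 2))) := by
        rw [h9]; ring_nf
    _ ≤ K * (√(k : ℝ))⁻¹ * ((1 + 8 / c ^ 2) * Real.exp (-(c / 2) * (k * s ^ 2))) := by gcongr
    _ = _ := by ring_nf

/-! ### Uniform asymptotics of reduced states and existence of the symbol. -/

theorem integrable_exp_gaussExponent {N : ℕ} {A : Matrix (Fin N) (Fin N) ℂ} (hA : A ∈ genDisk N)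
    (w ζ : CN N) (hw : ‖w‖ = 1) (hζ : inner ℂ w ζ = 0) {k : ℕ} (hk : 0 < k) :
    Integrable fun t : ℝ =>
      Complex.exp ((k : ℂ) * gaussExponent A ((Complex.I * (t : ℂ)) • w + ζ)) := by
  obtain ⟨c, hc, hE⟩ := exists_re_gaussExponent_le hA
  have hk0 : (0 : ℝ) < k := by exact_mod_cast hk
  have hg := integrable_exp_neg_mul_sq (b := k * c) (by positivity)
  refine hg.mono' ?_ (.of_forall fun t => ?_)
  · have := continuous_gaussExponent A
    exact Continuous.aestronglyMeasurable (by fun_prop)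
  · rw [Complex.norm_exp]
    apply Real.exp_le_exp.2
    have h1 := norm_smul_add_sq hw hζ (Complex.I * (t : ℂ)) 1 (by simp)
    rw [one_smul, norm_mul, Complex.norm_I, one_mul, Complex.norm_real, Real.norm_eq_abs,
      sq_abs] at h1
    have h2 := hE ((Complex.I * (t : ℂ)) • w + ζ)
    rw [h1] at h2
    have h3 : ((k : ℂ) * gaussExponent A ((Complex.I * (t : ℂ)) • w + ζ)).re =
      k * (gaussExponent A ((Complex.I * (t : ℂ)) • w + ζ)).re := by simp
    rw [h3]
    have h4 := mul_le_mul_of_nonneg_left h2 hk0.le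
    have h5 : 0 ≤ k * (c * ‖ζ‖ ^ 2) := by positivity
    nlinarith

/-- Substitution t ↦ √k t, using that the exponent is homogeneous of degree two under real scaling.
-/
theorem integral_exp_gaussExponent_eq {N : ℕ} (A : Matrix (Fin N) (Fin N) ℂ)
    (w ζ : CN N) {k : ℕ} (hk : 0 < k) :
    1 / (2 * (Real.pi : ℂ)) *
      ∫ t : ℝ, Complex.exp ((k : ℂ) * gaussExponent A ((Complex.I * (t : ℂ)) • w + ζ)) =
    (((√(k : ℝ))⁻¹ : ℝ) : ℂ) * symbolIntegral A w (((√(k : ℝ) : ℝ) : ℂ) • ζ) := by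
  have hsk0 : 0 < √(k : ℝ) := Real.sqrt_pos.2 (by exact_mod_cast hk)
  have hsk : √(k : ℝ) ^ 2 = k := Real.sq_sqrt (by positivity)
  set g := fun t : ℝ => Complex.exp (gaussExponent A
    ((Complex.I * (t : ℂ)) • w + ((√(k : ℝ) : ℝ) : ℂ) • ζ)) with hg
  have h1 : ∀ t : ℝ, Complex.exp ((k : ℂ) * gaussExponent A ((Complex.I * (t : ℂ)) • w + ζ)) =
      g (√(k : ℝ) * t) := by
    intro t
    have : (Complex.I * ((√(k : ℝ) * t : ℝ) : ℂ)) • w + ((√(k : ℝ) : ℝ) : ℂ) • ζ =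
        ((√(k : ℝ) : ℝ) : ℂ) • ((Complex.I * (t : ℂ)) • w + ζ) := by
      push_cast
      module
    simp only [hg]
    rw [this, gaussExponent_real_smul, ← Complex.ofReal_pow, hsk]
    simp
  simp only [h1]
  rw [Measure.integral_comp_mul_left g, symbolIntegral, abs_of_pos (inv_pos.2 hsk0),
    Complex.real_smul]
  ring

/-- The quantitative stationary phase estimate for reduced states. -/
theorem exists_norm_reducedState_sub_le {N : ℕ} {A : Matrix (Fin N) (Fin N) ℂ}
    (hA : A ∈ genDisk N) (w : CN N) (hw : ‖w‖ = 1) :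
    ∃ C > 0, ∃ c > 0, ∀ (k : ℕ) (ζ : CN N) (r : ℝ), 0 < k → inner ℂ w ζ = 0 → 1 / 2 ≤ r →
      r ≤ 1 → 1 - r ≤ ‖ζ‖ ^ 2 →
      ‖reducedState k A w ((r : ℂ) • w + ζ) -
        (((√(k : ℝ))⁻¹ : ℝ) : ℂ) * symbolIntegral A w (((√(k : ℝ) : ℝ) : ℂ) • ζ)‖ ≤
        C * (k : ℝ)⁻¹ * Real.exp (-c * k * ‖ζ‖ ^ 2) := by
  obtain ⟨C, hC, c, hc, hb⟩ := exists_norm_integrand_sub_le hA w hw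
  refine ⟨C * √(Real.pi / c), by positivity, c, hc, fun k ζ r hk hζ hr hr1 hrζ => ?_⟩
  have hk0 : (0 : ℝ) < k := by exact_mod_cast hk
  have hsk0 : 0 < √(k : ℝ) := Real.sqrt_pos.2 hk0
  have hi1 : Integrable ((Set.Ioc (-Real.pi) Real.pi).indicator
      (fun t => Complex.exp ((k : ℂ) * reducedPhase A w ((r : ℂ) • w + ζ) t))) := by
    rw [integrable_indicator_iff measurableSet_Ioc]
    have := continuous_reducedPhase A w ((r : ℂ) • w + ζ)
    exact (Continuous.integrableOn_Icc (by fun_prop)).mono_set Set.Ioc_subset_Icc_self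
  rw [reducedState_eq_integral k A w _ hw, ← integral_exp_gaussExponent_eq A w ζ hk, ← mul_sub,
    ← integral_sub hi1 (integrable_exp_gaussExponent hA w ζ hw hζ hk), norm_mul]
  have hint : Integrable fun t : ℝ =>
      C * (√(k : ℝ))⁻¹ * Real.exp (-c * k * (t ^ 2 + ‖ζ‖ ^ 2)) := by
    have hg := (integrable_exp_neg_mul_sq (b := c * k) (by positivity)).const_mul
      (C * (√(k : ℝ))⁻¹ * Real.exp (-c * k * ‖ζ‖ ^ 2))
    refine hg.congr (.of_forall fun t => ?_)
    simp only
    rw [mul_assoc (C * _), ← Real.exp_add]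
    ring_nf
  have hle := norm_integral_le_of_norm_le hint
    (.of_forall fun t => hb k ζ r t hk hζ hr hr1 hrζ)
  -- Integrating the Gaussian in t supplies the second factor k^{-1/2}.
  have hval : ∫ t : ℝ, C * (√(k : ℝ))⁻¹ * Real.exp (-c * k * (t ^ 2 + ‖ζ‖ ^ 2)) =
      C * √(Real.pi / c) * (k : ℝ)⁻¹ * Real.exp (-c * k * ‖ζ‖ ^ 2) := by
    have h1 : ∀ t : ℝ, C * (√(k : ℝ))⁻¹ * Real.exp (-c * k * (t ^ 2 + ‖ζ‖ ^ 2)) =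
        C * (√(k : ℝ))⁻¹ * Real.exp (-c * k * ‖ζ‖ ^ 2) * Real.exp (-(c * k) * t ^ 2) := by
      intro t
      rw [mul_assoc (C * _), ← Real.exp_add]
      ring_nf
    simp only [h1]
    rw [integral_const_mul, integral_gaussian, ← div_div, Real.sqrt_div' _ hk0.le]
    have h2 : (k : ℝ)⁻¹ = (√(k : ℝ))⁻¹ * (√(k : ℝ))⁻¹ := by
      rw [← mul_inv, Real.mul_self_sqrt hk0.le]
    rw [h2]
    ring
  rw [hval] at hle
  have hpi : ‖1 / (2 * (Real.pi : ℂ))‖ ≤ 1 := by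
    rw [norm_div, norm_one, norm_mul, Complex.norm_real, Real.norm_of_nonneg Real.pi_pos.le]
    rw [div_le_one (by simpa using Real.pi_pos)]
    norm_num
    linarith [Real.pi_gt_three]
  exact (mul_le_of_le_one_left (norm_nonneg _) hpi).trans hle

/-- Reduced states are uniformly small away from the circle through the base point. -/
theorem exists_norm_reducedState_le {N : ℕ} {A : Matrix (Fin N) (Fin N) ℂ}
    (hA : A ∈ genDisk N) (w : CN N) (hw : ‖w‖ = 1) :
    ∃ c > 0, ∀ (k : ℕ) (a : ℂ) (ζ : CN N), inner ℂ w ζ = 0 →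
      ‖reducedState k A w (a • w + ζ)‖ ≤ Real.exp (-c * k * ‖ζ‖ ^ 2) := by
  obtain ⟨c, hc, hE⟩ := exists_re_gaussExponent_le hA
  refine ⟨c, hc, fun k a ζ hζ => ?_⟩
  rw [reducedState, reduction, norm_mul]
  have hle := intervalIntegral.norm_integral_le_of_norm_le_const
    (a := 0) (b := 2 * Real.pi) (C := Real.exp (-c * k * ‖ζ‖ ^ 2))
    (f := fun t : ℝ => Complex.exp (-(Complex.I * (k : ℂ) * (t : ℂ))) *
      gaussianState k A w (Complex.exp (Complex.I * (t : ℂ)) • (a • w + ζ))) (fun t _ => by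
      rw [exp_mul_gaussianState k A w _ hw]
      change ‖Complex.exp ((k : ℂ) * reducedPhase A w (a • w + ζ) t)‖ ≤ _
      rw [Complex.norm_exp]
      apply Real.exp_le_exp.2
      have h3 : ((k : ℂ) * reducedPhase A w (a • w + ζ) t).re =
        k * (reducedPhase A w (a • w + ζ) t).re := by simp
      rw [h3, reducedPhase_re]
      have h1 : Complex.exp (Complex.I * t) • (a • w + ζ) - w =
          (Complex.exp (Complex.I * t) * a - 1) • w + Complex.exp (Complex.I * t) • ζ := by
        module
      have h2 := hE (Complex.exp (Complex.I * t) • (a • w + ζ) - w)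
      rw [h1, norm_smul_add_sq hw hζ _ _ (norm_exp_I_mul t)] at h2
      rw [h1]
      have hk0 : (0 : ℝ) ≤ k := Nat.cast_nonneg k
      have h4 := mul_le_mul_of_nonneg_left h2 hk0
      -- Discarding the decay along w makes the bound uniform in a and t.
      have h5 : 0 ≤ k * (c * ‖Complex.exp (Complex.I * t) * a - 1‖ ^ 2) := by positivity
      nlinarith)
  rw [sub_zero, abs_of_pos (by positivity)] at hle
  have hn : ‖1 / (2 * (Real.pi : ℂ))‖ = 1 / (2 * Real.pi) := by
    rw [norm_div, norm_one, norm_mul, Complex.norm_real, Real.norm_of_nonneg Real.pi_pos.le]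
    norm_num
  rw [hn]
  calc _ ≤ 1 / (2 * Real.pi) * (Real.exp (-c * k * ‖ζ‖ ^ 2) * (2 * Real.pi)) := by gcongr
    _ = _ := by field_simp

/-- The uniform estimate at r = 1, ζ = η/√k leaves an error √k · O(1/k). -/
theorem tendsto_rescaledState {N : ℕ} {A : Matrix (Fin N) (Fin N) ℂ} (hA : A ∈ genDisk N)
    (w : CN N) (hw : ‖w‖ = 1) (η : horizontal w) :
    Tendsto (rescaledState A w η) atTop (𝓝 (symbolIntegral A w η)) := by
  obtain ⟨C, hC, c, hc, hb⟩ := exists_norm_reducedState_sub_le hA w hw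
  rw [tendsto_iff_norm_sub_tendsto_zero]
  have hlim : Tendsto (fun k : ℕ => C * (√(k : ℝ))⁻¹) atTop (𝓝 0) := by
    rw [← mul_zero C]
    exact (tendsto_inv_atTop_zero.comp
      (Real.tendsto_sqrt_atTop.comp tendsto_natCast_atTop_atTop)).const_mul C
  refine squeeze_zero' (.of_forall fun _ => norm_nonneg _) ?_ hlim
  filter_upwards [eventually_gt_atTop 0] with k hk
  have hk0 : (0 : ℝ) < k := by exact_mod_cast hk
  have hsk0 : 0 < √(k : ℝ) := Real.sqrt_pos.2 hk0
  have hη : inner ℂ w (η : CN N) = 0 :=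
    Submodule.mem_orthogonal_singleton_iff_inner_right.1 η.2
  set ζ : CN N := (((√(k : ℝ))⁻¹ : ℝ) : ℂ) • (η : CN N) with hζ
  have h0 : inner ℂ w ζ = 0 := by rw [hζ, inner_smul_right, hη, mul_zero]
  have h1 := hb k ζ 1 hk h0 (by norm_num) le_rfl (by rw [sub_self]; positivity)
  have h2 : ((√(k : ℝ) : ℝ) : ℂ) • ζ = (η : CN N) := by
    rw [hζ, smul_smul, ← Complex.ofReal_mul, mul_inv_cancel₀ hsk0.ne', Complex.ofReal_one, one_smul]
  rw [h2, Complex.ofReal_one, one_smul] at h1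
  have h3 : rescaledState A w η k - symbolIntegral A w η = ((√(k : ℝ) : ℝ) : ℂ) *
      (reducedState k A w (w + ζ) - (((√(k : ℝ))⁻¹ : ℝ) : ℂ) * symbolIntegral A w η) := by
    rw [mul_sub, ← mul_assoc, ← Complex.ofReal_mul, mul_inv_cancel₀ hsk0.ne', Complex.ofReal_one,
      one_mul]
    rfl
  rw [h3, norm_mul, Complex.norm_real, Real.norm_of_nonneg hsk0.le]
  have h4 : Real.exp (-c * k * ‖ζ‖ ^ 2) ≤ 1 := by
    rw [Real.exp_le_one_iff]
    have : 0 ≤ c * k * ‖ζ‖ ^ 2 := by positivity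
    linarith
  have h5 : (k : ℝ)⁻¹ = (√(k : ℝ))⁻¹ * (√(k : ℝ))⁻¹ := by
    rw [← mul_inv, Real.mul_self_sqrt hk0.le]
  calc _ ≤ √(k : ℝ) * (C * (k : ℝ)⁻¹ * 1) := by
        gcongr
        exact h1.trans (by gcongr)
    _ = C * (√(k : ℝ))⁻¹ := by
        rw [h5]
        field_simp

theorem symbol_eq_symbolIntegral {N : ℕ} {A : Matrix (Fin N) (Fin N) ℂ} (hA : A ∈ genDisk N)
    (w : CN N) (hw : ‖w‖ = 1) (η : horizontal w) : symbol A w η = symbolIntegral A w η :=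
  (tendsto_rescaledState hA w hw η).limUnder_eq

/-! ### Comparison of two states with equal symbols. -/

/-- Reduced states with the same symbol are pointwise close on the unit sphere. -/
theorem exists_norm_reducedState_sub_reducedState_le {N : ℕ} {A B : Matrix (Fin N) (Fin N) ℂ}
    (hA : A ∈ genDisk N) (hB : B ∈ genDisk N) (w : CN N) (hw : ‖w‖ = 1)
    (hsymb : symbol A w = symbol B w) :
    ∃ C > 0, ∃ c > 0, ∀ (k : ℕ) (z : CN N), 0 < k → ‖z‖ = 1 →
      ‖reducedState k A w z - reducedState k B w z‖ ≤
        C * (k : ℝ)⁻¹ * Real.exp (-c * k * (1 - ‖(inner ℂ w z : ℂ)‖ ^ 2)) := by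
  obtain ⟨CA, hCA, cA, hcA, hbA⟩ := exists_norm_reducedState_sub_le hA w hw
  obtain ⟨CB, hCB, cB, hcB, hbB⟩ := exists_norm_reducedState_sub_le hB w hw
  obtain ⟨dA, hdA, heA⟩ := exists_norm_reducedState_le hA w hw
  obtain ⟨dB, hdB, heB⟩ := exists_norm_reducedState_le hB w hw
  -- The far-region rates are halved: one half stays as the Gaussian, the other is traded for 1/k.
  obtain ⟨c, hc, h1, h2, h3, h4⟩ : ∃ c > 0, c ≤ cA ∧ c ≤ cB ∧ 2 * c ≤ dA ∧ 2 * c ≤ dB := by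
    refine ⟨min (min cA cB) (min (dA / 2) (dB / 2)), by positivity, ?_, ?_, ?_, ?_⟩
    · exact (min_le_left _ _).trans (min_le_left _ _)
    · exact (min_le_left _ _).trans (min_le_right _ _)
    · linarith [(min_le_right (min cA cB) _).trans (min_le_left (dA / 2) (dB / 2))]
    · linarith [(min_le_right (min cA cB) _).trans (min_le_right (dA / 2) (dB / 2))]
  have hmono : ∀ {a b : ℝ} (k : ℕ) (x : ℝ), 0 ≤ x → a ≤ b →
      Real.exp (-b * k * x) ≤ Real.exp (-a * k * x) := by
    intro a b k x hx hab
    apply Real.exp_le_exp.2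
    have : a * (k * x) ≤ b * (k * x) := mul_le_mul_of_nonneg_right hab (by positivity)
    linarith
  refine ⟨CA + CB + 4 / c, by positivity, c, hc, fun k z hk hz => ?_⟩
  have hk0 : (0 : ℝ) < k := by exact_mod_cast hk
  set h : ℂ := inner ℂ w z with hh
  set ζ : CN N := z - h • w with hζ
  have hζn : ‖ζ‖ ^ 2 = 1 - ‖h‖ ^ 2 := by
    rw [hζ, hh, norm_sub_inner_smul_sq w hw, hz, one_pow]
  have hζo : inner ℂ w ζ = 0 := by
    rw [hζ, inner_sub_right, inner_smul_right, inner_self_eq_norm_sq_to_K, hw]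
    simp [hh]
  rw [← hζn]
  by_cases hr : 1 / 2 ≤ ‖h‖
  · have hr1 : ‖h‖ ≤ 1 := by
      simpa [hw, hz] using norm_inner_le_norm (𝕜 := ℂ) w z
    -- Rotating by the argument of ⟨w,z⟩ makes the w-component real and positive; both states change
    -- by the same unimodular factor.
    set e := Complex.exp (Complex.I * (h.arg : ℝ)) with he
    have hen : ‖e‖ = 1 := norm_exp_I_mul h.arg
    have he0 : e ≠ 0 := Complex.exp_ne_zero _
    have hpol : h = e * (‖h‖ : ℂ) := by
      rw [he, mul_comm, mul_comm Complex.I]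
      exact (Complex.norm_mul_exp_arg_mul_I h).symm
    set ζ' := e⁻¹ • ζ with hζ'
    have hz' : z = e • ((‖h‖ : ℂ) • w + ζ') := by
      rw [smul_add, smul_smul, ← hpol, hζ', smul_smul, mul_inv_cancel₀ he0, one_smul, hζ]
      abel
    have hn' : ‖ζ'‖ = ‖ζ‖ := by rw [hζ', norm_smul, norm_inv, hen, inv_one, one_mul]
    have ho' : inner ℂ w ζ' = 0 := by rw [hζ', inner_smul_right, hζo, mul_zero]
    have hcov : ∀ M : Matrix (Fin N) (Fin N) ℂ, reducedState k M w z =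
        Complex.exp (Complex.I * k * h.arg) * reducedState k M w ((‖h‖ : ℂ) • w + ζ') := by
      intro M
      conv_lhs => rw [hz']
      exact reduction_exp_smul k _ _ _
    have hnk : ‖Complex.exp (Complex.I * k * h.arg)‖ = 1 := by
      have : Complex.I * k * h.arg = Complex.I * ((k * h.arg : ℝ) : ℂ) := by push_cast; ring
      rw [this]
      exact norm_exp_I_mul _
    have hrz : 1 - ‖h‖ ≤ ‖ζ'‖ ^ 2 := by
      rw [hn', hζn]
      nlinarith [norm_nonneg h]
    have hsi : symbolIntegral A w (((√(k : ℝ) : ℝ) : ℂ) • ζ') =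
        symbolIntegral B w (((√(k : ℝ) : ℝ) : ℂ) • ζ') := by
      have hmem : ((√(k : ℝ) : ℝ) : ℂ) • ζ' ∈ horizontal w :=
        Submodule.smul_mem _ _ (Submodule.mem_orthogonal_singleton_iff_inner_right.2 ho')
      have := congrFun hsymb ⟨_, hmem⟩
      rwa [symbol_eq_symbolIntegral hA w hw, symbol_eq_symbolIntegral hB w hw] at this
    have b1 := hbA k ζ' ‖h‖ hk ho' hr hr1 hrz
    have b2 := hbB k ζ' ‖h‖ hk ho' hr hr1 hrz
    rw [hsi] at b1
    rw [hn'] at b1 b2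
    rw [hcov A, hcov B, ← mul_sub, norm_mul, hnk, one_mul]
    refine (norm_sub_le_norm_sub_add_norm_sub _ _ _).trans ((add_le_add b1
      ((norm_sub_rev _ _).trans_le b2)).trans ?_)
    have m1 := hmono k (‖ζ‖ ^ 2) (by positivity) h1
    have m2 := hmono k (‖ζ‖ ^ 2) (by positivity) h2
    calc _ ≤ CA * (k : ℝ)⁻¹ * Real.exp (-c * k * ‖ζ‖ ^ 2) +
          CB * (k : ℝ)⁻¹ * Real.exp (-c * k * ‖ζ‖ ^ 2) := by gcongr
      _ = (CA + CB + 0) * (k : ℝ)⁻¹ * Real.exp (-c * k * ‖ζ‖ ^ 2) := by ring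
      _ ≤ _ := by gcongr; positivity
  · push Not at hr
    have hz' : z = h • w + ζ := by rw [hζ]; abel
    have b1 := heA k h ζ hζo
    have b2 := heB k h ζ hζo
    rw [← hz'] at b1 b2
    have m1 := hmono k (‖ζ‖ ^ 2) (by positivity) h3
    have m2 := hmono k (‖ζ‖ ^ 2) (by positivity) h4
    have h34 : 3 / 4 ≤ ‖ζ‖ ^ 2 := by
      rw [hζn]
      nlinarith [norm_nonneg h]
    have hsplit : Real.exp (-(2 * c) * k * ‖ζ‖ ^ 2) =
        Real.exp (-c * k * ‖ζ‖ ^ 2) * Real.exp (-c * k * ‖ζ‖ ^ 2) := by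
      rw [← Real.exp_add]; ring_nf
    -- This is e^{-x} ≤ 1/x with x ≥ ck/2, as ‖ζ‖² ≥ 3/4.
    have hinv : Real.exp (-c * k * ‖ζ‖ ^ 2) ≤ 2 / c * (k : ℝ)⁻¹ := by
      have e1 : -c * k * ‖ζ‖ ^ 2 = -(c * k * ‖ζ‖ ^ 2) := by ring
      rw [e1, Real.exp_neg, inv_le_comm₀ (Real.exp_pos _) (by positivity)]
      have e2 : (2 / c * (k : ℝ)⁻¹)⁻¹ = c * k * (1 / 2) := by field_simp
      rw [e2]
      have e3 : c * k * (1 / 2) ≤ c * k * ‖ζ‖ ^ 2 := by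
        gcongr
        linarith
      linarith [Real.add_one_le_exp (c * k * ‖ζ‖ ^ 2)]
    refine (norm_sub_le _ _).trans ((add_le_add (b1.trans m1) (b2.trans m2)).trans ?_)
    rw [hsplit]
    calc _ = 2 * Real.exp (-c * k * ‖ζ‖ ^ 2) * Real.exp (-c * k * ‖ζ‖ ^ 2) := by ring
      _ ≤ 2 * (2 / c * (k : ℝ)⁻¹) * Real.exp (-c * k * ‖ζ‖ ^ 2) := by gcongr
      _ = (0 + 4 / c) * (k : ℝ)⁻¹ * Real.exp (-c * k * ‖ζ‖ ^ 2) := by ring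
      _ ≤ _ := by gcongr; positivity

theorem isBigO_sphereNormSq {N : ℕ} {A B : Matrix (Fin N) (Fin N) ℂ}
    (hA : A ∈ genDisk N) (hB : B ∈ genDisk N) (w : CN N) (hw : ‖w‖ = 1)
    (hsymb : symbol A w = symbol B w) :
    (fun k : ℕ => sphereNormSq (reducedState k A w - reducedState k B w))
      =O[atTop] (fun k : ℕ => (k : ℝ) ^ (-(N : ℤ) - 1)) := by
  obtain ⟨C, hC, c, hc, hb⟩ :=
    exists_norm_reducedState_sub_reducedState_le hA hB w hw hsymb
  have hN : 1 ≤ N := by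
    rcases Nat.eq_zero_or_pos N with rfl | h
    · have : w = 0 := Subsingleton.elim w 0
      simp [this] at hw
    · exact h
  refine IsBigO.of_bound
    (C ^ 2 * (2 * N * Real.exp 1 * Real.pi * (Real.pi / (2 * c)) ^ (N - 1))) ?_
  filter_upwards [eventually_gt_atTop 0] with k hk
  have hk0 : (0 : ℝ) < k := by exact_mod_cast hk
  -- The first factor is the squared pointwise bound; the second comes from the 2(N-1) real
  -- directions orthogonal to the complex line. N ≥ 1 makes the natural subtraction exact.
  have hpow : (k : ℝ) ^ (-(N : ℤ) - 1) = ((k : ℝ)⁻¹) ^ 2 * ((k : ℝ)⁻¹) ^ (N - 1) := by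
    rw [← pow_add, show 2 + (N - 1) = N + 1 by omega, inv_pow, ← zpow_natCast, ← zpow_neg]
    congr 1
    push_cast
    ring
  have hint : Integrable (fun z : Metric.sphere (0 : CN N) 1 => (C * (k : ℝ)⁻¹) ^ 2 *
      Real.exp (-(2 * c * k) * (1 - ‖(inner ℂ w (z : CN N) : ℂ)‖ ^ 2)))
      ((volume : Measure (CN N)).toSphere) :=
    Continuous.integrable_of_hasCompactSupport (by fun_prop) (HasCompactSupport.of_compactSpace _)
  have hnn : 0 ≤ sphereNormSq (reducedState k A w - reducedState k B w) :=
    integral_nonneg fun _ => sq_nonneg _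
  rw [Real.norm_of_nonneg hnn, Real.norm_of_nonneg (by positivity), hpow]
  calc sphereNormSq (reducedState k A w - reducedState k B w)
      ≤ ∫ z : Metric.sphere (0 : CN N) 1, (C * (k : ℝ)⁻¹) ^ 2 *
          Real.exp (-(2 * c * k) * (1 - ‖(inner ℂ w (z : CN N) : ℂ)‖ ^ 2))
          ∂((volume : Measure (CN N)).toSphere) := by
        refine integral_mono (integrable_reducedState_sub k A B w) hint fun z => ?_
        have h1 := pow_le_pow_left₀ (norm_nonneg _) (hb k z hk (by simp)) 2
        refine h1.trans (le_of_eq ?_)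
        rw [mul_pow, ← Real.exp_nat_mul]
        congr 2
        push_cast
        ring
    _ ≤ (C * (k : ℝ)⁻¹) ^ 2 *
          (2 * N * Real.exp 1 * Real.pi * (Real.pi / (2 * c * k)) ^ (N - 1)) := by
        rw [integral_const_mul]
        gcongr
        exact integral_sphere_exp_le w hw (by positivity)
    _ = _ := by
        rw [← div_div, div_eq_mul_inv _ (k : ℝ), mul_pow, mul_pow]
        ring

end Squeezed

end

theorem corollary3p2 (N : ℕ) (A B : Matrix (Fin N) (Fin N) ℂ)
    (hA : A ∈ Squeezed.genDisk N) (hB : B ∈ Squeezed.genDisk N)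
    (w : Squeezed.CN N) (hw : ‖w‖ = 1) :
    (∀ η : Squeezed.horizontal w,
      Tendsto (Squeezed.rescaledState A w η) atTop (𝓝 (Squeezed.symbol A w η))) ∧
    (∀ η : Squeezed.horizontal w,
      Tendsto (Squeezed.rescaledState B w η) atTop (𝓝 (Squeezed.symbol B w η))) ∧
    (Squeezed.symbol A w = Squeezed.symbol B w →
      (fun k : ℕ => Squeezed.sphereNormSq
        (Squeezed.reducedState k A w - Squeezed.reducedState k B w))
        =O[atTop] (fun k : ℕ => (k : ℝ) ^ (-(N : ℤ) - 1))) := by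
  refine ⟨fun η => ?_, fun η => ?_, Squeezed.isBigO_sphereNormSq hA hB w hw⟩
  · rw [Squeezed.symbol_eq_symbolIntegral hA w hw]
    exact Squeezed.tendsto_rescaledState hA w hw η
  · rw [Squeezed.symbol_eq_symbolIntegral hB w hw]
    exact Squeezed.tendsto_rescaledState hB w hw η
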